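/- All graphs are finite and simple. A triangulation (respectively quadrangulation) is a connected simple plane graph every face of which, including the outer one, is bounded by a triangle (respectively by a $4$-cycle). A graph is $k$-connected if it has more than $k$ vertices and the deletion of any fewer than $k$ vertices leaves a connected graph. For a vertex $v$ of a connected graph $G$ let $e(v)=\max_{u\in V(G)} d_G(v,u)$ denote its eccentricity, and for $0\le i\le e(v)$ let $n_i(v)$ be the number of vertices at distance exactly $i$ from $v$. Plane graphs are considered up to homeomorphism of the sphere, i.e. an embedding of a connected graph with at least one edge is given by a rotation system (a cyclic order of the edges at each vertex) whose face-tracing orbits satisfy $|V|-|E|+|F|=2$. **Lemma.** (a) Let $G$ be a $5$-connected simple triangulation, $v$ a vertex of $G$ and $d=e(v)$. If $n_{d-1}(v)=5$, then $n_d(v)=1$. (b) Let $G$ be a $3$-connected simple quadrangulation, $v$ a vertex of $G$ and $d=e(v)$. If $n_{d-1}(v)=3$, then $n_d(v)=1$. If $n_{d-2}(v)=3$ and $n_{d-1}(v)=4$, then $n_d(v)>1$. -/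

import Mathlib

namespace SimpleGraph

variable {V : Type*}

/-- A graph on a finite vertex set is `k`-connected if it has more than `k` vertices and the
deletion of fewer than `k` vertices always leaves a connected graph. -/
def IsVertexConnected (G : SimpleGraph V) (k : ℕ) : Prop :=
  k < Nat.card V ∧ ∀ S : Finset V, S.card < k → (G.induce ((S : Set V)ᶜ)).Connected

/-- `N_i(v)`: the set of vertices at distance exactly `i` from `v`. -/
def distLayer (G : SimpleGraph V) (v : V) (i : ℕ) : Set V :=
  {u | G.edist v u = i}

/-- `n_i(v) = |N_i(v)|`. -/
noncomputable def layerCard (G : SimpleGraph V) (v : V) (i : ℕ) : ℕ :=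
  (G.distLayer v i).ncard

/-- A rotation system of `G`: a permutation of the darts (oriented edges) which, at each vertex `x`,
cyclically permutes the darts leaving `x`. It describes a cellular embedding of a connected graph
in an oriented closed surface: `rot e` is the dart that follows `e` in the counterclockwise order
around the initial vertex of `e`. -/
structure RotationSystem (G : SimpleGraph V) where
  /-- the successor of a dart around its initial vertex -/
  rot : Equiv.Perm G.Dart
  rot_fst : ∀ e : G.Dart, (rot e).fst = e.fst
  rot_sameCycle : ∀ e f : G.Dart, e.fst = f.fst → rot.SameCycle e f

namespace RotationSystem

variable {G : SimpleGraph V}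

/-- The permutation of the darts that walks along face boundaries: from the dart `(x, y)` pass to
the dart that follows `(y, x)` in the rotation around `y`. -/
def facePerm (R : RotationSystem G) : Equiv.Perm G.Dart :=
  (Function.Involutive.toPerm Dart.symm Dart.symm_involutive).trans R.rot

/-- The faces of the embedding: the orbits of the darts under `facePerm`. -/
def Face (R : RotationSystem G) : Type _ :=
  Quotient (Equiv.Perm.SameCycle.setoid R.facePerm)

/-- The face whose boundary contains the dart `e` is a `k`-cycle: its boundary walk started
at `e` closes up after `k` steps and visits `k` distinct vertices. -/
def FaceIsCycle (R : RotationSystem G) (k : ℕ) (e : G.Dart) : Prop :=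
  (R.facePerm ^ k) e = e ∧
    Function.Injective fun i : Fin k => ((R.facePerm ^ (i : ℕ)) e).fst

end RotationSystem

/-- A (combinatorial) plane embedding of a finite connected graph with at least one edge: a rotation
system whose surface is the sphere, that is, has Euler characteristic `|V| - |E| + |F| = 2`. -/
structure PlaneEmbedding (G : SimpleGraph V) extends RotationSystem G where
  connected : G.Connected
  euler : (Nat.card V : ℤ) - (Nat.card G.edgeSet : ℤ) + (Nat.card toRotationSystem.Face : ℤ) = 2

namespace PlaneEmbedding

variable {G : SimpleGraph V}

/-- A simple triangulation: a simple plane graph every face of which is a triangle. -/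
def IsTriangulation (P : PlaneEmbedding G) : Prop :=
  ∀ e : G.Dart, P.FaceIsCycle 3 e

/-- A simple quadrangulation: a simple plane graph every face of which is a `4`-cycle. -/
def IsQuadrangulation (P : PlaneEmbedding G) : Prop :=
  ∀ e : G.Dart, P.FaceIsCycle 4 e

end PlaneEmbedding

end SimpleGraph

/-! The proof is a face count outside a ball around `v`. If faces whose boundaries lie in a
connected graph `H` on `Z` are collapsed one by one, each from an edge whose other side is not in
the collection, `H` loses one edge per face and stays connected. Hence `|Z| + #faces inside Z ≤
#edges inside Z + 1` for every proper `Z` inducing a connected subgraph. Subtracting this from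
Euler's formula gives, for the complement `W`, `1 ≤ |W| - #edges meeting W + #faces meeting W`.
Distributing each edge over its two faces bounds the faces with many corners in `W`: `t₂ + t₃ ≤ 2|W|
- 2` for triangles, and `q₃ + q₄ ≤ |W| - 1` for 4-cycles when no face has exactly two corners in `W`
that are adjacent on it (the index is the number of corners in `W`).

(a) Let `C` and `D` be the last two layers and `A` the rest. The bound is used for `W = C ∪ D` and
for the set `D'` of non-isolated vertices of the graph induced on `D`. By connectivity every vertex
of `C` has neighbors on both sides, which gives five triangles of type `ACC`; every vertex of `D'`
gives one of type `CDD`. With degrees at least 5 in `D`, this forces `D' = ∅` and then `|D| ≤ 1`.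

(b) The graph is bipartite, so colors are parities of distance. Let `W` be the vertices at distance
at least `j`, `S` the layer `j`, and `X` the vertices of `W` of the other color. Then `q₃ ≥ |S|`
and, by degrees, `3|X| ≤ q₃ + 2q₄`, so `6|X| + 2|S| + 4 ≤ 4|W|`. Both claims are instances with `|S|
= 3`. -/

namespace SimpleGraph

/-! ### Faces of a rotation system and collapsing them -/

namespace RotationSystem

variable {V : Type*} {G : SimpleGraph V} (R : RotationSystem G)

theorem facePerm_apply (e : G.Dart) : R.facePerm e = R.rot e.symm := rfl

theorem facePerm_symm (e : G.Dart) : R.facePerm e.symm = R.rot e := by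
  rw [facePerm_apply, Dart.symm_symm]

theorem facePerm_fst (e : G.Dart) : (R.facePerm e).fst = e.snd := R.rot_fst _

theorem facePerm_pow_succ_fst (e : G.Dart) (i : ℕ) :
    ((R.facePerm ^ (i + 1)) e).fst = ((R.facePerm ^ i) e).snd := by
  rw [pow_succ', Equiv.Perm.mul_apply, facePerm_fst]

/-- The face whose boundary contains a dart. -/
def faceOf (e : G.Dart) : R.Face := Quotient.mk (Equiv.Perm.SameCycle.setoid R.facePerm) e

theorem faceOf_eq_iff {e f : G.Dart} :
    R.faceOf e = R.faceOf f ↔ R.facePerm.SameCycle e f :=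
  Quotient.eq (r := Equiv.Perm.SameCycle.setoid R.facePerm)

theorem faceOf_surjective : Function.Surjective R.faceOf := Quotient.mk_surjective

instance [Finite V] : Finite G.Dart :=
  Finite.of_injective (fun e : G.Dart => e.toProd) (Dart.toProd_injective)

instance [Finite V] : Finite R.Face := Finite.of_surjective _ R.faceOf_surjective

theorem faceOf_pow (e : G.Dart) (i : ℕ) : R.faceOf ((R.facePerm ^ i) e) = R.faceOf e :=
  R.faceOf_eq_iff.2 (Equiv.Perm.sameCycle_pow_left.2 (Equiv.Perm.SameCycle.refl _ _))

theorem faceOf_facePerm (e : G.Dart) : R.faceOf (R.facePerm e) = R.faceOf e :=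
  R.faceOf_pow e 1

/-- A nonempty set of darts closed under reversal and rotation contains all the darts of a connected
graph. -/
theorem forall_of_symm_rot [Finite V] (hG : G.Connected) (p : G.Dart → Prop)
    (hs : ∀ e, p e → p e.symm) (hr : ∀ e, p e → p (R.rot e)) {e₀ : G.Dart} (h₀ : p e₀)
    (e : G.Dart) : p e := by
  have hrot : ∀ e f : G.Dart, e.fst = f.fst → p e → p f := by
    intro e f h he
    obtain ⟨i, -, rfl⟩ := (R.rot_sameCycle e f h).exists_pow_eq'
    clear h
    induction i with
    | zero => exact he
    | succ i ih => rw [pow_succ', Equiv.Perm.mul_apply]; exact hr _ ih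
  have key : ∀ x y (w : G.Walk x y), (∀ f : G.Dart, f.fst = x → p f) →
      ∀ f : G.Dart, f.fst = y → p f := by
    intro x y w
    induction w with
    | nil => exact id
    | cons h w ih =>
      intro hx
      refine ih fun f hf => ?_
      exact hrot (Dart.symm ⟨(_, _), h⟩) f hf.symm (hs _ (hx _ rfl))
  exact key _ _ (hG e₀.fst e.fst).some (fun f hf => hrot _ f hf.symm h₀) e rfl

/-- A set of faces that is neither empty nor everything has a boundary edge. -/
theorem exists_boundary_dart [Finite V] (hG : G.Connected) {T : Finset R.Face} (hT : T.Nonempty)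
    {f : R.Face} (hf : f ∉ T) : ∃ e, R.faceOf e ∈ T ∧ R.faceOf e.symm ∉ T := by
  by_contra! h
  obtain ⟨g, hg⟩ := hT
  obtain ⟨e, rfl⟩ := R.faceOf_surjective g
  obtain ⟨e', rfl⟩ := R.faceOf_surjective f
  refine hf (R.forall_of_symm_rot hG (fun e => R.faceOf e ∈ T) h (fun e he => ?_) hg e')
  rw [← facePerm_symm, faceOf_facePerm]
  exact h e he

/-- One face of `T` and one of its edges, whose other side is not in `T`, can be removed from a
subgraph that contains all the boundaries of the faces in `T`; the ends of the removed edge remain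
joined by the rest of the face boundary. -/
theorem exists_walk_deleteEdges {k : ℕ} (hk : 0 < k) (hR : ∀ e : G.Dart, R.FaceIsCycle k e)
    {Z : Set V} {T : Finset R.Face} {H : SimpleGraph Z}
    (hT : ∀ e, R.faceOf e ∈ T → ∃ (hx : e.fst ∈ Z) (hy : e.snd ∈ Z),
      H.Adj ⟨e.fst, hx⟩ ⟨e.snd, hy⟩)
    {e : G.Dart} (he : R.faceOf e ∈ T) (hes : R.faceOf e.symm ∉ T)
    (hx : e.fst ∈ Z) (hy : e.snd ∈ Z) :
    ∃ w : (H.deleteEdges {s(⟨e.fst, hx⟩, ⟨e.snd, hy⟩)}).Walk ⟨e.snd, hy⟩ ⟨e.fst, hx⟩,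
      w.length + 1 = k := by
  set H' := H.deleteEdges {s(⟨e.fst, hx⟩, ⟨e.snd, hy⟩)} with hH'
  have hmem : ∀ i, ((R.facePerm ^ i) e).fst ∈ Z := fun i =>
    (hT _ (by rwa [R.faceOf_pow])).1
  have hadj : ∀ i, 0 < i → i < k →
      H'.Adj ⟨((R.facePerm ^ i) e).fst, hmem i⟩ ⟨((R.facePerm ^ (i + 1)) e).fst, hmem (i + 1)⟩ := by
    intro i hi hik
    obtain ⟨h1, h2, h3⟩ := hT ((R.facePerm ^ i) e) (by rwa [R.faceOf_pow])
    rw [hH', deleteEdges_adj]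
    simp only [R.facePerm_pow_succ_fst]
    refine ⟨h3, fun hmem => ?_⟩
    simp only [Set.mem_singleton_iff, Sym2.eq_iff, Subtype.mk.injEq] at hmem
    -- The deleted edge does not recur on the face: in the same direction it would repeat a vertex,
    -- in the opposite one `e.symm` would lie on a face of `T`.
    rcases hmem with ⟨h, h'⟩ | ⟨h, h'⟩
    · have := @(hR e).2 ⟨i, hik⟩ ⟨0, hk⟩ h
      simp only [Fin.mk.injEq] at this
      omega
    · refine hes ?_
      have : e.symm = (R.facePerm ^ i) e := by
        ext
        · exact h.symm
        · exact h'.symm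
      rw [this, R.faceOf_pow]
      exact he
  have key : ∀ i, i < k →
      ∃ w : H'.Walk ⟨((R.facePerm ^ 1) e).fst, hmem 1⟩
        ⟨((R.facePerm ^ (i + 1)) e).fst, hmem (i + 1)⟩, w.length = i := by
    intro i
    induction i with
    | zero => exact fun _ => ⟨Walk.nil, rfl⟩
    | succ i ih =>
      intro hi
      obtain ⟨w, hw⟩ := ih (by omega)
      exact ⟨w.concat (hadj (i + 1) (by omega) hi), by rw [Walk.length_concat, hw]⟩
  obtain ⟨w, hw⟩ := key (k - 1) (by omega)
  have h1 : (⟨((R.facePerm ^ 1) e).fst, hmem 1⟩ : Z) = ⟨e.snd, hy⟩ :=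
    Subtype.ext (R.facePerm_fst e)
  have h2 : (⟨((R.facePerm ^ (k - 1 + 1)) e).fst, hmem (k - 1 + 1)⟩ : Z) = ⟨e.fst, hx⟩ := by
    apply Subtype.ext
    change ((R.facePerm ^ (k - 1 + 1)) e).fst = e.fst
    rw [Nat.sub_add_cancel hk, (hR e).1]
  exact ⟨w.copy h1 h2, by rw [Walk.length_copy, hw]; omega⟩

/-- The color flips at every step. This carries a coloring across a deleted edge, and later compares
colors with parities of distance. -/
theorem eq_ite_even_length_of_walk {W : Type*} {H : SimpleGraph W} {c : W → Bool}
    (hc : ∀ x y, H.Adj x y → c x = !c y) {x y : W} (w : H.Walk x y) :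
    c x = if Even w.length then c y else !c y := by
  induction w with
  | nil => simp
  | cons h w ih =>
    rw [hc _ _ h, ih]
    by_cases h : Even w.length <;> simp [h, Nat.even_add_one]

/-- Collapsing faces: if `T` is a set of faces, not all, whose boundaries lie in the connected
graph `H`, then `#T` edges can be removed from `H` such that it stays connected, and, for faces
of even length, such that `2`-colorings are not affected. -/
theorem exists_connected_collapse [Finite V] (hG : G.Connected) {k : ℕ} (hk : 0 < k)
    (hR : ∀ e : G.Dart, R.FaceIsCycle k e) {Z : Set V} (f : R.Face) :
    ∀ (n : ℕ) (T : Finset R.Face) (H : SimpleGraph Z), T.card = n → f ∉ T → H.Connected →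
      (∀ e, R.faceOf e ∈ T → ∃ (hx : e.fst ∈ Z) (hy : e.snd ∈ Z),
        H.Adj ⟨e.fst, hx⟩ ⟨e.snd, hy⟩) →
      ∃ H' : SimpleGraph Z, H'.Connected ∧ Nat.card H'.edgeSet + n = Nat.card H.edgeSet ∧
        (Even k → ∀ c : Z → Bool, (∀ x y, H'.Adj x y → c x = !c y) →
          ∀ x y, H.Adj x y → c x = !c y) := by
  classical
  intro n
  induction n with
  | zero => exact fun T H _ _ hH _ => ⟨H, hH, rfl, fun _ c hc => hc⟩
  | succ n ih =>
    intro T H hn hf hH hT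
    obtain ⟨e, he, hes⟩ := R.exists_boundary_dart hG (Finset.card_pos.1 (by omega)) hf
    obtain ⟨hx, hy, hadj⟩ := hT e he
    obtain ⟨w, hw⟩ := R.exists_walk_deleteEdges hk hR hT he hes hx hy
    have hconn := hH.connected_delete_edge_of_not_isBridge
      (x := ⟨e.fst, hx⟩) (y := ⟨e.snd, hy⟩) (by rw [isBridge_iff, not_not]; exact w.reachable.symm)
    obtain ⟨H', h1, h2, h3⟩ := ih (T.erase (R.faceOf e))
      (H.deleteEdges {s(⟨e.fst, hx⟩, ⟨e.snd, hy⟩)})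
      (by rw [Finset.card_erase_of_mem he, hn]; rfl) (fun h => hf (Finset.mem_of_mem_erase h))
      hconn (fun e' he' => by
        obtain ⟨hne, hm⟩ := Finset.mem_erase.1 he'
        obtain ⟨hx', hy', h'⟩ := hT e' hm
        refine ⟨hx', hy', ?_⟩
        rw [deleteEdges_adj]
        refine ⟨h', fun hmem => ?_⟩
        simp only [Set.mem_singleton_iff, Sym2.eq_iff, Subtype.mk.injEq] at hmem
        rcases hmem with ⟨h, h'⟩ | ⟨h, h'⟩
        · exact hne (congrArg _ (Dart.ext _ _ (Prod.ext h h')))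
        · have : e' = e.symm := Dart.ext _ _ (Prod.ext h h')
          exact hes (this ▸ hm))
    refine ⟨H', h1, ?_, fun hev c hc => ?_⟩
    · have : Nat.card (H.deleteEdges {s(⟨e.fst, hx⟩, ⟨e.snd, hy⟩)}).edgeSet + 1
          = Nat.card H.edgeSet := by
        rw [edgeSet_deleteEdges]
        exact Set.ncard_sdiff_singleton_add_one (s := H.edgeSet) hadj
      omega
    · have hc' := h3 hev c hc
      have hcw := eq_ite_even_length_of_walk hc' w
      -- The rest of the face boundary has odd length `k - 1`, so the ends of the deleted edge have
      -- different colors already.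
      rw [if_neg (by rw [← hw, Nat.even_add_one] at hev; exact hev)] at hcw
      intro x y hxy
      by_cases hmem : s(x, y) = s(⟨e.fst, hx⟩, ⟨e.snd, hy⟩)
      · rcases Sym2.eq_iff.1 hmem with ⟨rfl, rfl⟩ | ⟨rfl, rfl⟩
        · rw [hcw, Bool.not_not]
        · exact hcw
      · exact hc' x y (by rw [deleteEdges_adj]; exact ⟨hxy, hmem⟩)

/-- If all the faces are `k`-cycles, then every face has exactly `k` darts. -/
theorem card_faceOf_eq [Finite V] {k : ℕ} (hk : 0 < k)
    (hR : ∀ e : G.Dart, R.FaceIsCycle k e) (f : R.Face) :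
    Nat.card {e // R.faceOf e = f} = k := by
  obtain ⟨e, rfl⟩ := R.faceOf_surjective f
  have hb : Function.Bijective (fun i : Fin k =>
      (⟨(R.facePerm ^ (i : ℕ)) e, R.faceOf_pow e i⟩ : {e' // R.faceOf e' = R.faceOf e})) := by
    constructor
    · intro i j hij
      exact (hR e).2 (congrArg (fun d : {e' // R.faceOf e' = R.faceOf e} => d.1.fst) hij)
    · rintro ⟨e', he'⟩
      obtain ⟨i, -, hi⟩ := (R.faceOf_eq_iff.1 he'.symm).exists_pow_eq'
      refine ⟨⟨i % k, Nat.mod_lt _ hk⟩, Subtype.ext ?_⟩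
      have hper : Function.IsPeriodicPt R.facePerm k e := by
        have := (hR e).1
        rwa [← Equiv.Perm.iterate_eq_pow] at this
      have := hper.iterate_mod_apply i
      simp only [Equiv.Perm.iterate_eq_pow] at this
      change (R.facePerm ^ (i % k)) e = e'
      rw [this, hi]
  rw [← Nat.card_eq_of_bijective _ hb, Nat.card_fin]

theorem card_faceOf_mem [Finite V] [Fintype G.Dart] {k : ℕ} (hk : 0 < k)
    (hR : ∀ e : G.Dart, R.FaceIsCycle k e) (T : Finset R.Face)
    [DecidablePred fun e => R.faceOf e ∈ T] :
    (Finset.univ.filter fun e => R.faceOf e ∈ T).card = k * T.card := by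
  classical
  rw [Finset.card_eq_sum_card_fiberwise (f := R.faceOf) (t := T) (fun e he => by simpa using he),
    Finset.sum_const_nat (m := k), mul_comm]
  intro f hf
  rw [← R.card_faceOf_eq hk hR f, Nat.card_eq_fintype_card, Fintype.card_subtype,
    Finset.filter_filter]
  congr 1
  ext e
  simp only [Finset.mem_filter, Finset.mem_univ, true_and, and_iff_right_iff_imp]
  rintro rfl
  exact hf

end RotationSystem
end SimpleGraph

/-! ### Euler's formula as sums over darts -/

namespace SimpleGraph

/-- The indicator function of a set of vertices. -/
noncomputable def vertexIndicator {V : Type*} (Z : Set V) (x : V) : ℤ := Z.indicator 1 x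

section

variable {V : Type*} {G : SimpleGraph V}

theorem vertexIndicator_of_mem {Z : Set V} {x : V} (h : x ∈ Z) : vertexIndicator Z x = 1 := by
  simp [vertexIndicator, h]

theorem vertexIndicator_of_notMem {Z : Set V} {x : V} (h : x ∉ Z) : vertexIndicator Z x = 0 := by
  simp [vertexIndicator, h]

theorem sum_vertexIndicator_mul [Finite V] [Fintype G.Dart] (Z : Set V) :
    ∑ e : G.Dart, vertexIndicator Z e.fst * vertexIndicator Z e.snd
      = 2 * (Nat.card (G.induce Z).edgeSet : ℤ) := by
  classical
  have := Fintype.ofFinite V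
  have h1 : (Finset.univ.filter fun e : G.Dart => e.fst ∈ Z ∧ e.snd ∈ Z).card
      = Fintype.card (G.induce Z).Dart := by
    rw [← Fintype.card_subtype]
    exact Fintype.card_congr
      { toFun := fun e => ⟨(⟨e.1.fst, e.2.1⟩, ⟨e.1.snd, e.2.2⟩), e.1.adj⟩
        invFun := fun e => ⟨⟨(e.fst, e.snd), e.adj⟩, e.fst.2, e.snd.2⟩
        left_inv := fun _ => rfl
        right_inv := fun _ => rfl }
  rw [dart_card_eq_twice_card_edges, edgeFinset_card, ← Nat.card_eq_fintype_card] at h1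
  have h2 : (2 * (Nat.card (G.induce Z).edgeSet : ℤ))
      = ((2 * Nat.card (G.induce Z).edgeSet : ℕ) : ℤ) := by push_cast; rfl
  rw [h2, ← h1, Finset.card_filter, Nat.cast_sum]
  refine Finset.sum_congr rfl fun e _ => ?_
  by_cases hx : e.fst ∈ Z <;> by_cases hy : e.snd ∈ Z <;>
    simp [vertexIndicator_of_mem, vertexIndicator_of_notMem, hx, hy]

namespace PlaneEmbedding

variable [Finite V] (P : G.PlaneEmbedding)

/-- Euler's formula multiplied by `2k`, with edges and faces eliminated: there are twice as many
darts as edges and `k` times as many as faces. -/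
theorem euler_dart [Fintype G.Dart] {k : ℕ} (hk : 0 < k) (hP : ∀ e : G.Dart, P.FaceIsCycle k e) :
    ((k : ℤ) - 2) * Fintype.card G.Dart = 2 * k * Nat.card V - 4 * k := by
  classical
  have := Fintype.ofFinite P.Face
  have := Fintype.ofFinite V
  have h1 := P.card_faceOf_mem hk hP Finset.univ
  simp only [Finset.mem_univ, Finset.filter_true, Finset.card_univ] at h1
  have h2 : Fintype.card G.Dart = 2 * Nat.card G.edgeSet := by
    rw [Nat.card_eq_fintype_card, ← edgeFinset_card]
    convert G.dart_card_eq_twice_card_edges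
  have h3 := P.euler
  rw [Nat.card_eq_fintype_card (α := P.Face)] at h3
  zify at h1 h2
  linear_combination (-2 : ℤ) * h1 + k * h2 - 2 * (k : ℤ) * h3

/-- Collapsing all faces inside `Z` leaves a connected graph, which has at least `|Z| - 1` edges.
The dart `e₀` provides a face outside the collection, without which no collapse could start. The
product sum counts each inner face `k` times, the other sum each inner edge twice. -/
theorem euler_le [Fintype G.Dart] {k : ℕ} (hk : 0 < k) (hP : ∀ e : G.Dart, P.FaceIsCycle k e) {Z : Set V}
    (hZ : (G.induce Z).Connected) {e₀ : G.Dart} (h₀ : e₀.fst ∉ Z) :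
    2 * (k : ℤ) * Z.ncard
        + 2 * ∑ e : G.Dart, ∏ i ∈ Finset.range k, vertexIndicator Z ((P.facePerm ^ i) e).fst
      ≤ k * ∑ e : G.Dart, vertexIndicator Z e.fst * vertexIndicator Z e.snd + 2 * k := by
  classical
  have := Fintype.ofFinite P.Face
  set T : Finset P.Face := Finset.univ.filter fun f => ∀ e, P.faceOf e = f → e.fst ∈ Z with hT
  have hTmem : ∀ e, P.faceOf e ∈ T ↔ ∀ i < k, ((P.facePerm ^ i) e).fst ∈ Z := by
    intro e
    simp only [hT, Finset.mem_filter, Finset.mem_univ, true_and]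
    refine ⟨fun h i _ => h _ (P.faceOf_pow e i), fun h e' he' => ?_⟩
    obtain ⟨i, -, rfl⟩ := (P.faceOf_eq_iff.1 he'.symm).exists_pow_eq'
    have hper : Function.IsPeriodicPt P.facePerm k e := by
      have := (hP e).1
      rwa [← Equiv.Perm.iterate_eq_pow] at this
    have := hper.iterate_mod_apply i
    simp only [Equiv.Perm.iterate_eq_pow] at this
    rw [← this]
    exact h _ (Nat.mod_lt _ hk)
  obtain ⟨H', h1, h2, -⟩ := P.exists_connected_collapse P.connected hk hP (P.faceOf e₀) _ T
    (G.induce Z) rfl (by simpa [hT] using ⟨e₀, rfl, h₀⟩) hZ (fun e he => by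
      simp only [hT, Finset.mem_filter, Finset.mem_univ, true_and] at he
      refine ⟨he e rfl, ?_, e.adj⟩
      rw [← P.facePerm_fst]
      exact he _ (P.faceOf_facePerm e))
  have h3 := h1.card_vert_le_card_edgeSet_add_one
  have h4 : ∑ e : G.Dart, ∏ i ∈ Finset.range k, vertexIndicator Z ((P.facePerm ^ i) e).fst
      = k * (T.card : ℤ) := by
    rw [← Nat.cast_mul, ← P.card_faceOf_mem hk hP T, Finset.card_filter, Nat.cast_sum]
    refine Finset.sum_congr rfl fun e _ => ?_
    by_cases h : P.faceOf e ∈ T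
    · rw [if_pos h, Finset.prod_eq_one fun i hi => vertexIndicator_of_mem
        ((hTmem e).1 h i (Finset.mem_range.1 hi))]
      rfl
    · rw [if_neg h]
      rw [hTmem] at h
      push Not at h
      obtain ⟨i, hi, hiZ⟩ := h
      exact Finset.prod_eq_zero (Finset.mem_range.2 hi) (vertexIndicator_of_notMem hiZ)
  have h5 : Z.ncard + T.card ≤ Nat.card (G.induce Z).edgeSet + 1 := by
    have : Nat.card Z = Z.ncard := rfl
    omega
  rw [h4, sum_vertexIndicator_mul]
  have h6 : (Z.ncard : ℤ) + T.card ≤ Nat.card (G.induce Z).edgeSet + 1 := by exact_mod_cast h5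
  nlinarith [mul_le_mul_of_nonneg_left h6 (Int.natCast_nonneg k)]

/-- A plane graph all of whose faces have the same even length is bipartite. -/
theorem exists_two_coloring {k : ℕ} (hk : 0 < k) (hev : Even k)
    (hP : ∀ e : G.Dart, P.FaceIsCycle k e) (e₀ : G.Dart) :
    ∃ c : V → Bool, ∀ x y, G.Adj x y → c x = !c y := by
  classical
  have := Fintype.ofFinite P.Face
  have he : ∀ e : G.Dart, P.faceOf e ∈ Finset.univ.erase (P.faceOf e₀) →
      ∃ (hx : e.fst ∈ Set.univ) (hy : e.snd ∈ Set.univ),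
        (G.induce Set.univ).Adj ⟨e.fst, hx⟩ ⟨e.snd, hy⟩ :=
    fun e _ => ⟨trivial, trivial, e.adj⟩
  obtain ⟨H', h1, h2, h3⟩ := P.exists_connected_collapse P.connected hk hP (P.faceOf e₀) _
    (Finset.univ.erase (P.faceOf e₀)) (G.induce Set.univ) rfl (Finset.notMem_erase _ _)
    ((induceUnivIso G).connected_iff.2 P.connected) he
  -- With all faces but one collapsed, Euler's formula leaves exactly `|V| - 1` edges.
  have htree : H'.IsTree := by
    refine isTree_iff_connected_and_card.2 ⟨h1, ?_⟩
    rw [Finset.card_erase_of_mem (Finset.mem_univ _), Finset.card_univ,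
      Nat.card_congr (induceUnivIso G).mapEdgeSet] at h2
    have h4 : 0 < Fintype.card P.Face := Fintype.card_pos_iff.2 ⟨P.faceOf e₀⟩
    have h5 := P.euler
    rw [Nat.card_eq_fintype_card (α := P.Face)] at h5
    have h6 : Nat.card (Set.univ : Set V) = Nat.card V := Nat.card_congr (Equiv.Set.univ V)
    omega
  have hcol := h3 hev (fun x => decide (htree.coloringTwo x = 0)) (fun x y hxy => by
    have := htree.coloringTwo.valid hxy
    generalize htree.coloringTwo x = a at *
    generalize htree.coloringTwo y = b at *
    revert a b
    decide)
  exact ⟨fun x => decide (htree.coloringTwo ⟨x, trivial⟩ = 0), fun x y hxy => hcol _ _ hxy⟩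

end PlaneEmbedding
end
end SimpleGraph

/-! ### Corners, degrees and distance layers -/

namespace SimpleGraph

section

variable {V : Type*} {G : SimpleGraph V}

theorem vertexIndicator_eq_zero_or_one (Z : Set V) (x : V) :
    vertexIndicator Z x = 0 ∨ vertexIndicator Z x = 1 := by
  by_cases h : x ∈ Z
  · exact Or.inr (vertexIndicator_of_mem h)
  · exact Or.inl (vertexIndicator_of_notMem h)

theorem Connected.exists_adj_boundary {H : SimpleGraph V} (hH : H.Connected) (Q : V → Prop)
    {x y : V} (hx : Q x) (hy : ¬Q y) : ∃ a b, H.Adj a b ∧ Q a ∧ ¬Q b := by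
  obtain ⟨d, -, h1, h2⟩ := (hH x y).some.exists_boundary_dart {z | Q z} hx hy
  exact ⟨d.fst, d.snd, d.adj, h1, h2⟩

/-- Walking around a vertex that has neighbors inside and outside of `Q`, one passes from `Q` to
its complement. -/
theorem RotationSystem.exists_corner [Finite V] (R : RotationSystem G) (Q : V → Prop) {x y z : V}
    (hxy : G.Adj x y) (hxz : G.Adj x z) (hy : Q y) (hz : ¬Q z) :
    ∃ e : G.Dart, (R.facePerm e).fst = x ∧ Q e.fst ∧ ¬Q ((R.facePerm (R.facePerm e)).fst) := by
  by_contra! h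
  have key : ∀ e : G.Dart, e.fst = x → Q e.snd → Q (R.rot e).snd := by
    intro e he hQ
    have := h e.symm (by rw [R.facePerm_fst]; exact he) hQ
    rwa [R.facePerm_fst, R.facePerm_symm] at this
  obtain ⟨i, -, hi⟩ := (R.rot_sameCycle ⟨(x, y), hxy⟩ ⟨(x, z), hxz⟩ rfl).exists_pow_eq'
  have : ∀ j : ℕ, ((R.rot ^ j) ⟨(x, y), hxy⟩).fst = x ∧ Q ((R.rot ^ j) ⟨(x, y), hxy⟩).snd := by
    intro j
    induction j with
    | zero => exact ⟨rfl, hy⟩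
    | succ j ih =>
      rw [pow_succ', Equiv.Perm.mul_apply, R.rot_fst]
      exact ⟨ih.1, key _ ih.1 ih.2⟩
  have h2 := (this i).2
  rw [hi] at h2
  exact hz h2

/-- Since `φ` recovers `x` from its dart, distinct elements of `C` contribute distinct darts. -/
theorem ncard_le_sum_dart [Finite V] [Fintype G.Dart] (C : Set V) (φ : G.Dart → V) (g : G.Dart → ℤ)
    (hg : ∀ e, 0 ≤ g e) (hC : ∀ x ∈ C, ∃ e, φ e = x ∧ 1 ≤ g e) :
    (C.ncard : ℤ) ≤ ∑ e, g e := by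
  classical
  have h1 : C.ncard ≤ (Finset.univ.filter fun e => 1 ≤ g e).card := by
    rw [← Set.ncard_coe_finset]
    refine (Set.ncard_le_ncard (t := φ '' _) (fun x hx => ?_) (Set.toFinite _)).trans
      (Set.ncard_image_le (Set.toFinite _))
    obtain ⟨e, he, h⟩ := hC x hx
    exact ⟨e, by simpa using h, he⟩
  have h2 : ((Finset.univ.filter fun e => 1 ≤ g e).card : ℤ) ≤ ∑ e, g e := by
    rw [Finset.card_filter, Nat.cast_sum]
    refine Finset.sum_le_sum fun e _ => ?_
    have := hg e
    split_ifs with h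
    · exact_mod_cast h
    · exact_mod_cast this
  exact le_trans (by exact_mod_cast h1) h2

theorem mul_ncard_le_sum_dart [Finite V] [Fintype G.Dart] {X : Set V} {m : ℕ}
    (hX : ∀ x ∈ X, m ≤ (G.neighborSet x).ncard) :
    (m * X.ncard : ℤ) ≤ ∑ e : G.Dart, vertexIndicator X e.fst := by
  classical
  have := Fintype.ofFinite V
  have h1 : ∑ e : G.Dart, vertexIndicator X e.fst
      = ((Finset.univ.filter fun e : G.Dart => e.fst ∈ X).card : ℤ) := by
    rw [Finset.card_filter, Nat.cast_sum]
    refine Finset.sum_congr rfl fun e _ => ?_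
    by_cases h : e.fst ∈ X <;> simp [h, vertexIndicator]
  rw [h1, Finset.card_eq_sum_card_fiberwise (f := fun e : G.Dart => e.fst) (t := X.toFinset)
    (fun e he => by simpa using he), Set.ncard_eq_toFinset_card' X, mul_comm]
  norm_cast
  rw [← smul_eq_mul]
  refine Finset.card_nsmul_le_sum _ _ _ fun x hx => (hX x (by simpa using hx)).trans ?_
  rw [← Set.ncard_coe_finset]
  refine (Set.ncard_le_ncard (t := (fun e : G.Dart => e.snd) '' _) (fun y hy => ?_)
    (Set.toFinite _)).trans (Set.ncard_image_le (Set.toFinite _))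
  exact ⟨⟨(x, y), hy⟩, by simpa using hx, rfl⟩

/-- Otherwise deleting the neighbors would isolate `x` from a vertex that exists because there are
more than `k` vertices. -/
theorem IsVertexConnected.le_ncard_neighborSet [Finite V] {k : ℕ} (h : G.IsVertexConnected k)
    (x : V) : k ≤ (G.neighborSet x).ncard := by
  by_contra! hlt
  have hfin := (G.neighborSet x).toFinite
  have hc := h.2 hfin.toFinset (by rwa [← Set.ncard_eq_toFinset_card _ hfin])
  rw [hfin.coe_toFinset] at hc
  obtain ⟨w, hw⟩ : ∃ w, w ∉ insert x (G.neighborSet x) := by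
    by_contra! hall
    have h1 := Set.ncard_insert_le x (G.neighborSet x)
    rw [Set.eq_univ_of_forall hall, Set.ncard_univ] at h1
    have := h.1
    omega
  rw [Set.mem_insert_iff, not_or] at hw
  obtain ⟨a, b, hab, ha, -⟩ := hc.exists_adj_boundary (fun z => z.1 = x)
    (x := ⟨x, by simp⟩) (y := ⟨w, hw.2⟩) rfl hw.1
  have hab' : G.Adj a.1 b.1 := hab
  rw [ha] at hab'
  exact b.2 hab'

theorem Connected.exists_adj_dist_lt (hG : G.Connected) {v u : V} (h : u ≠ v) :
    ∃ w, G.Adj w u ∧ G.dist v w + 1 = G.dist v u := by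
  obtain ⟨p, hp⟩ := hG.exists_walk_length_eq_dist u v
  cases p with
  | nil => exact absurd rfl h
  | @cons _ w _ hadj q =>
    refine ⟨w, hadj.symm, ?_⟩
    rw [Walk.length_cons] at hp
    have h1 := dist_le q
    have h2 := hG.dist_triangle (u := v) (v := w) (w := u)
    rw [dist_eq_one_iff_adj.2 hadj.symm] at h2
    rw [dist_comm (u := v) (v := w), dist_comm (u := v) (v := u)] at *
    omega

theorem Adj.dist_le_add_one (hG : G.Connected) {x y : V} (h : G.Adj x y) (v : V) :
    G.dist v y ≤ G.dist v x + 1 := by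
  have h2 := hG.dist_triangle (u := v) (v := x) (w := y)
  rwa [dist_eq_one_iff_adj.2 h] at h2

theorem connected_induce_of_dist {Z : Set V} {v : V} (hv : v ∈ Z)
    (h : ∀ u ∈ Z, u ≠ v → ∃ w ∈ Z, G.Adj w u ∧ G.dist v w < G.dist v u) :
    (G.induce Z).Connected := by
  have key : ∀ n (u : V) (hu : u ∈ Z), G.dist v u = n → (G.induce Z).Reachable ⟨v, hv⟩ ⟨u, hu⟩ := by
    intro n
    induction n using Nat.strong_induction_on with
    | _ n ih =>
      intro u hu hn
      by_cases huv : u = v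
      · subst huv; rfl
      · obtain ⟨w, hw, hadj, hlt⟩ := h u hu huv
        refine (ih _ (hn ▸ hlt) w hw rfl).trans (Adj.reachable ?_)
        exact hadj
  exact (connected_iff_exists_forall_reachable _).2 ⟨⟨v, hv⟩, fun u => key _ u u.2 rfl⟩

/-- If `|N_j(v)| ≤ k` in a `k`-connected graph, then every vertex of `N_j(v)` has a neighbor that is
further away from `v`, provided that some vertex is further away. -/
theorem IsVertexConnected.exists_adj_dist_gt [Finite V] (hG : G.Connected) {k j : ℕ}
    (h : G.IsVertexConnected k) {v x u : V} (hj : 0 < j)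
    (hcard : {w | G.dist v w = j}.ncard ≤ k) (hx : G.dist v x = j) (hu : j < G.dist v u) :
    ∃ y, G.Adj x y ∧ j < G.dist v y := by
  -- Fewer than `k` vertices are deleted: the layer without `x`. An edge out of the ball of radius
  -- `j` that survives must start at `x`.
  have hfin := ({w | G.dist v w = j} \ {x}).toFinite
  have hc := h.2 hfin.toFinset (by
    rw [← Set.ncard_eq_toFinset_card _ hfin]
    have := Set.ncard_sdiff_singleton_lt_of_mem (s := {w | G.dist v w = j}) (a := x) hx
      (Set.toFinite _)
    omega)
  rw [hfin.coe_toFinset] at hc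
  obtain ⟨a, b, hab, ha, hb⟩ := hc.exists_adj_boundary (fun z => G.dist v z.1 ≤ j)
    (x := ⟨v, by simp [hj.ne]⟩) (y := ⟨u, by simp [hu.ne']⟩) (by simp) (by simpa using hu)
  have hab' : G.Adj a.1 b.1 := hab
  have h1 := hab'.dist_le_add_one hG v
  have hax : a.1 = x := by
    by_contra hne
    exact a.2 ⟨by simp only [Set.mem_ofPred_eq]; omega, hne⟩
  rw [hax] at hab' h1
  exact ⟨b.1, hab', by simpa using hb⟩

end
end SimpleGraph

/-! ### Triangulations -/

namespace SimpleGraph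

namespace PlaneEmbedding

section

variable {V : Type*} {G : SimpleGraph V} {P : G.PlaneEmbedding}

theorem IsTriangulation.facePerm_cube (hP : P.IsTriangulation) (e : G.Dart) :
    P.facePerm (P.facePerm (P.facePerm e)) = e := (hP e).1

theorem IsTriangulation.sum_rotate [Fintype G.Dart] (hP : P.IsTriangulation)
    (F : V → V → V → ℤ) :
    ∑ e : G.Dart, F (P.facePerm e).fst (P.facePerm (P.facePerm e)).fst e.fst
      = ∑ e : G.Dart, F e.fst (P.facePerm e).fst (P.facePerm (P.facePerm e)).fst := by
  rw [← Equiv.sum_comp P.facePerm fun e : G.Dart =>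
    F e.fst (P.facePerm e).fst (P.facePerm (P.facePerm e)).fst]
  simp only [hP.facePerm_cube]

theorem IsTriangulation.adj_fst_third (hP : P.IsTriangulation) (e : G.Dart) :
    G.Adj (P.facePerm (P.facePerm e)).fst e.fst := by
  have h := (P.facePerm (P.facePerm e)).adj
  rwa [← P.facePerm_fst, hP.facePerm_cube] at h

/-- In a triangulation, if `Z` induces a connected subgraph and `W` is its nonempty complement,
then (each triangle being counted three times) the number of triangles with two or three corners
in `W` is at most `2|W| - 2`. -/
theorem IsTriangulation.sum_le [Finite V] [Fintype G.Dart] (hP : P.IsTriangulation) {Z W : Set V}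
    (hW : Zᶜ = W) (hZ : (G.induce Z).Connected) {e₀ : G.Dart} (h₀ : e₀.fst ∈ W) :
    3 * ∑ e : G.Dart, vertexIndicator Z e.fst * vertexIndicator W (P.facePerm e).fst *
          vertexIndicator W (P.facePerm (P.facePerm e)).fst
      + ∑ e : G.Dart, vertexIndicator W e.fst * vertexIndicator W (P.facePerm e).fst *
          vertexIndicator W (P.facePerm (P.facePerm e)).fst ≤ 6 * W.ncard - 6 := by
  subst hW
  have hw : ∀ x, vertexIndicator Zᶜ x = 1 - vertexIndicator Z x := by
    intro x
    by_cases h : x ∈ Z <;> simp [vertexIndicator, h]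
  have h1 := P.euler_le (by norm_num) hP hZ h₀
  have h2 := P.euler_dart (by norm_num) hP
  have h3 : (Z.ncard : ℤ) + Zᶜ.ncard = Nat.card V := by exact_mod_cast Set.ncard_add_ncard_compl Z
  simp only [hw, Finset.prod_range_succ, Finset.prod_range_zero, one_mul, pow_zero,
    Equiv.Perm.one_apply, pow_one, pow_two, Equiv.Perm.mul_apply, ← P.facePerm_fst] at h1 ⊢
  have r1 := hP.sum_rotate fun x _ _ => vertexIndicator Z x
  have r2 := hP.sum_rotate fun _ x _ => vertexIndicator Z x
  have r3 := hP.sum_rotate fun x y _ => vertexIndicator Z x * vertexIndicator Z y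
  have r4 := hP.sum_rotate fun _ x y => vertexIndicator Z x * vertexIndicator Z y
  rw [← Finset.card_univ, Finset.card_eq_sum_ones] at h2
  push_cast at h1 h2
  -- After rotation the linear terms cancel, leaving `#darts - 3 ∑ z z + 2 ∑ z z z`, which the two
  -- Euler relations bound.
  have key : 3 * ∑ e : G.Dart, vertexIndicator Z e.fst *
        (1 - vertexIndicator Z (P.facePerm e).fst) *
          (1 - vertexIndicator Z (P.facePerm (P.facePerm e)).fst)
      + ∑ e : G.Dart, (1 - vertexIndicator Z e.fst) *
        (1 - vertexIndicator Z (P.facePerm e).fst) *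
          (1 - vertexIndicator Z (P.facePerm (P.facePerm e)).fst)
      = ∑ e : G.Dart, 1
        + 2 * ∑ e : G.Dart, vertexIndicator Z e.fst
        - ∑ e : G.Dart, vertexIndicator Z (P.facePerm e).fst
        - ∑ e : G.Dart, vertexIndicator Z (P.facePerm (P.facePerm e)).fst
        - 2 * ∑ e : G.Dart, vertexIndicator Z e.fst * vertexIndicator Z (P.facePerm e).fst
        - 2 * ∑ e : G.Dart, vertexIndicator Z (P.facePerm (P.facePerm e)).fst *
            vertexIndicator Z e.fst
        + ∑ e : G.Dart, vertexIndicator Z (P.facePerm e).fst *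
            vertexIndicator Z (P.facePerm (P.facePerm e)).fst
        + 2 * ∑ e : G.Dart, vertexIndicator Z e.fst * vertexIndicator Z (P.facePerm e).fst *
          vertexIndicator Z (P.facePerm (P.facePerm e)).fst := by
    simp only [Finset.mul_sum, ← Finset.sum_add_distrib, ← Finset.sum_sub_distrib]
    exact Finset.sum_congr rfl fun e _ => by ring
  rw [key]
  linarith

/-- In a triangulation, let the vertices be divided into `A`, `C` and `D` such that no edge
joins `A` to `D`, and every vertex of `C` has neighbors in `A` and in `D`. If `A` and the complement
of the set `D'` of the non-isolated vertices of `D` are connected, `|C| = 5` and the vertices of `D`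
have degree at least `5`, then `|D| ≤ 1`. -/
theorem IsTriangulation.ncard_le_one [Finite V] (hP : P.IsTriangulation) {A C D : Set V}
    (hcover : ∀ x, x ∈ A ∧ x ∉ C ∧ x ∉ D ∨ x ∉ A ∧ x ∈ C ∧ x ∉ D ∨ x ∉ A ∧ x ∉ C ∧ x ∈ D)
    (hAD : ∀ x y, G.Adj x y → x ∈ A → y ∉ D) (hA : (G.induce A).Connected)
    (hD : (G.induce {x | x ∈ D ∧ ∃ y ∈ D, G.Adj x y}ᶜ).Connected)
    (hCA : ∀ x ∈ C, ∃ y ∈ A, G.Adj x y) (hCD : ∀ x ∈ C, ∃ y ∈ D, G.Adj x y)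
    (hDC : ∀ x ∈ D, ∃ y ∈ C, G.Adj x y)
    (hC : C.ncard = 5) (hdeg : ∀ x ∈ D, 5 ≤ (G.neighborSet x).ncard) : D.ncard ≤ 1 := by
  have := Fintype.ofFinite G.Dart
  -- Isolated vertices of `D` lie on no `CDD` triangle; leaving them out makes the lower bound `hβ`
  -- match the upper bound `second`.
  set D' : Set V := {x | x ∈ D ∧ ∃ y ∈ D, G.Adj x y} with hD'
  set a := vertexIndicator A with ha
  set c := vertexIndicator C with hc
  set δ := vertexIndicator D with hδ
  have hac : ∀ x, vertexIndicator Aᶜ x = c x + δ x := by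
    intro x
    rcases hcover x with ⟨h1, h2, h3⟩ | ⟨h1, h2, h3⟩ | ⟨h1, h2, h3⟩ <;>
      simp [hc, hδ, vertexIndicator, h1, h2, h3]
  have hsum : ∀ x, a x + c x + δ x = 1 := by
    intro x
    rcases hcover x with ⟨h1, h2, h3⟩ | ⟨h1, h2, h3⟩ | ⟨h1, h2, h3⟩ <;>
      simp [ha, hc, hδ, vertexIndicator, h1, h2, h3]
  have h01 : ∀ (Z : Set V) x, 0 ≤ vertexIndicator Z x := fun Z x => by
    rcases vertexIndicator_eq_zero_or_one Z x with h | h <;> simp [h]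
  have haδ : ∀ x y, G.Adj x y → a x * δ y = 0 := by
    intro x y hxy
    by_cases hx : x ∈ A
    · simp [hδ, vertexIndicator_of_notMem (hAD x y hxy hx)]
    · simp [ha, vertexIndicator_of_notMem hx]
  have hδδ : ∀ x y, G.Adj x y → vertexIndicator D' x * vertexIndicator D' y = δ x * δ y := by
    intro x y hxy
    by_cases hx : x ∈ D <;> by_cases hy : y ∈ D
    · rw [vertexIndicator_of_mem (Z := D') ⟨hx, y, hy, hxy⟩,
        vertexIndicator_of_mem (Z := D') ⟨hy, x, hx, hxy.symm⟩, hδ, vertexIndicator_of_mem hx,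
        vertexIndicator_of_mem hy]
    · rw [vertexIndicator_of_notMem (Z := D') (x := y) fun h => hy h.1, hδ,
        vertexIndicator_of_notMem hy, mul_zero, mul_zero]
    · rw [vertexIndicator_of_notMem (Z := D') (x := x) fun h => hx h.1, hδ,
        vertexIndicator_of_notMem hx, zero_mul, zero_mul]
    · rw [vertexIndicator_of_notMem (Z := D') (x := y) fun h => hy h.1, hδ,
        vertexIndicator_of_notMem hy, mul_zero, mul_zero]
  have adj1 : ∀ e : G.Dart, G.Adj e.fst (P.facePerm e).fst := fun e => by
    rw [P.facePerm_fst]; exact e.adj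
  have adj2 : ∀ e : G.Dart, G.Adj (P.facePerm e).fst (P.facePerm (P.facePerm e)).fst :=
    fun e => adj1 _
  have adj3 := hP.adj_fst_third
  set Sα := ∑ e : G.Dart, δ e.fst * δ (P.facePerm e).fst * δ (P.facePerm (P.facePerm e)).fst
  set Sβ := ∑ e : G.Dart, c e.fst * δ (P.facePerm e).fst * δ (P.facePerm (P.facePerm e)).fst
  set Sγ := ∑ e : G.Dart, δ e.fst * c (P.facePerm e).fst * c (P.facePerm (P.facePerm e)).fst
  have hβ1 := hP.sum_rotate fun x y z => c x * δ y * δ z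
  have hβ2 : ∑ e : G.Dart, δ (P.facePerm e).fst * c (P.facePerm (P.facePerm e)).fst * δ e.fst
      = Sβ :=
    (hP.sum_rotate fun x y z => δ x * c y * δ z).trans
      ((Finset.sum_congr rfl fun e _ => by ring).trans hβ1)
  have hγ1 := hP.sum_rotate fun x y z => δ x * c y * c z
  have hγ2 : ∑ e : G.Dart, c (P.facePerm e).fst * δ (P.facePerm (P.facePerm e)).fst * c e.fst
      = Sγ :=
    (hP.sum_rotate fun x y z => c x * δ y * c z).trans
      ((Finset.sum_congr rfl fun e _ => by ring).trans hγ1)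
  -- Corners in `D` by triangle type: `Sβ` and `Sγ` count `CDD` and `DCC` triangles once, `Sα`
  -- counts `DDD` triangles three times.
  have corner : ∑ e : G.Dart, δ e.fst = Sα + 2 * Sβ + Sγ := by
    have : ∑ e : G.Dart, δ e.fst = Sα
        + ∑ e : G.Dart, c (P.facePerm e).fst * δ (P.facePerm (P.facePerm e)).fst * δ e.fst
        + ∑ e : G.Dart, δ (P.facePerm e).fst * c (P.facePerm (P.facePerm e)).fst * δ e.fst
        + Sγ := by
      rw [← Finset.sum_add_distrib, ← Finset.sum_add_distrib, ← Finset.sum_add_distrib]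
      refine Finset.sum_congr rfl fun e _ => ?_
      have e1 := hsum (P.facePerm e).fst
      have e2 := hsum (P.facePerm (P.facePerm e)).fst
      have e3 := haδ _ _ (adj1 e).symm
      have e4 := haδ _ _ (adj3 e)
      linear_combination (-δ e.fst * (c (P.facePerm (P.facePerm e)).fst
        + δ (P.facePerm (P.facePerm e)).fst)) * e1 - δ e.fst * e2 + (c (P.facePerm (P.facePerm e)).fst
        + δ (P.facePerm (P.facePerm e)).fst) * e3 + e4
    linarith
  -- Around a vertex of `C` the neighbors pass from `A` to its complement; the new neighbor is
  -- adjacent to one in `A`, hence lies in `C`.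
  have five : (5 : ℤ) ≤ ∑ e : G.Dart, a e.fst * c (P.facePerm e).fst *
      c (P.facePerm (P.facePerm e)).fst := by
    have := ncard_le_sum_dart C (fun e => (P.facePerm e).fst) (fun e : G.Dart => a e.fst *
      c (P.facePerm e).fst * c (P.facePerm (P.facePerm e)).fst)
      (fun e => mul_nonneg (mul_nonneg (h01 _ _) (h01 _ _)) (h01 _ _)) fun x hx => by
        obtain ⟨y, hy, hxy⟩ := hCA x hx
        obtain ⟨z, hz, hxz⟩ := hCD x hx
        have := hcover z
        obtain ⟨e, he1, he2, he3⟩ := P.exists_corner (· ∈ A) hxy hxz hy (by tauto)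
        have h3 := hAD _ _ (adj3 e).symm he2
        have h4 := hcover (P.facePerm (P.facePerm e)).fst
        refine ⟨e, he1, ?_⟩
        rw [ha, hc, vertexIndicator_of_mem he2, vertexIndicator_of_mem (x := (P.facePerm e).fst)
          (he1 ▸ hx), vertexIndicator_of_mem (by tauto)]
        norm_num
    rwa [hC] at this
  have hβ : (D'.ncard : ℤ) ≤ Sβ := by
    refine ncard_le_sum_dart D' (fun e => (P.facePerm e).fst) _
      (fun e => mul_nonneg (mul_nonneg (h01 _ _) (h01 _ _)) (h01 _ _)) fun x hx => ?_
    obtain ⟨y, hy, hxy⟩ := hDC x hx.1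
    obtain ⟨z, hz, hxz⟩ := hx.2
    have := hcover z
    obtain ⟨e, he1, he2, he3⟩ := P.exists_corner (· ∈ C) hxy hxz hy (by tauto)
    have h3 := fun h => hAD _ _ (adj2 e).symm h (he1 ▸ hx.1)
    have h4 := hcover (P.facePerm (P.facePerm e)).fst
    refine ⟨e, he1, ?_⟩
    rw [hδ, hc, vertexIndicator_of_mem he2, vertexIndicator_of_mem (x := (P.facePerm e).fst)
      (he1 ▸ hx.1), vertexIndicator_of_mem (by tauto)]
    norm_num
  have hle : D'.ncard ≤ D.ncard := Set.ncard_le_ncard (fun x hx => hx.1) (Set.toFinite _)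
  have first : 15 + (3 * Sγ + 3 * Sβ + Sα) ≤ 6 * (5 + D.ncard) - 6 := by
    obtain ⟨x, hx⟩ := (Set.ncard_pos (Set.toFinite C)).1 (by omega)
    obtain ⟨y, -, hxy⟩ := hCA x hx
    have hx' := hcover x
    have h := hP.sum_le rfl hA (e₀ := ⟨(x, y), hxy⟩) (show x ∉ A by tauto)
    have hAc : Aᶜ = C ∪ D := by
      ext z
      have := hcover z
      simp only [Set.mem_compl_iff, Set.mem_union]
      tauto
    have hcard : Aᶜ.ncard = 5 + D.ncard := by
      rw [hAc, Set.ncard_union_eq (Set.disjoint_left.2 fun z h1 h2 => by have := hcover z; tauto)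
        (Set.toFinite _) (Set.toFinite _), hC]
    rw [hcard] at h
    simp only [hac] at h
    have e1 : ∑ e : G.Dart, vertexIndicator A e.fst *
        (c (P.facePerm e).fst + δ (P.facePerm e).fst) * (c (P.facePerm (P.facePerm e)).fst
          + δ (P.facePerm (P.facePerm e)).fst) = ∑ e : G.Dart, a e.fst * c (P.facePerm e).fst *
      c (P.facePerm (P.facePerm e)).fst := by
      refine Finset.sum_congr rfl fun e _ => ?_
      linear_combination (c (P.facePerm (P.facePerm e)).fst
          + δ (P.facePerm (P.facePerm e)).fst) * haδ _ _ (adj1 e)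
        + c (P.facePerm e).fst * haδ _ _ (adj3 e).symm
    have e2 : ∑ e : G.Dart, (c e.fst + δ e.fst) * (c (P.facePerm e).fst + δ (P.facePerm e).fst)
          * (c (P.facePerm (P.facePerm e)).fst + δ (P.facePerm (P.facePerm e)).fst)
        = ∑ e : G.Dart, c e.fst * c (P.facePerm e).fst * c (P.facePerm (P.facePerm e)).fst
          + Sα + Sβ + Sγ
          + ∑ e : G.Dart, c (P.facePerm e).fst * δ (P.facePerm (P.facePerm e)).fst * δ e.fst
          + ∑ e : G.Dart, δ (P.facePerm e).fst * c (P.facePerm (P.facePerm e)).fst * δ e.fst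
          + ∑ e : G.Dart, δ (P.facePerm e).fst * c (P.facePerm (P.facePerm e)).fst * c e.fst
          + ∑ e : G.Dart, c (P.facePerm e).fst * δ (P.facePerm (P.facePerm e)).fst * c e.fst := by
      simp only [Sα, Sβ, Sγ, ← Finset.sum_add_distrib]
      exact Finset.sum_congr rfl fun e _ => by ring
    have e3 : 0 ≤ ∑ e : G.Dart, c e.fst * c (P.facePerm e).fst *
        c (P.facePerm (P.facePerm e)).fst :=
      Finset.sum_nonneg fun e _ => mul_nonneg (mul_nonneg (h01 _ _) (h01 _ _)) (h01 _ _)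
    rw [e1, e2] at h
    push_cast at h
    linarith
  have second : D'.Nonempty → 3 * Sβ + Sα ≤ 6 * D'.ncard - 6 := by
    rintro ⟨x, hx⟩
    obtain ⟨y, hy, hxy⟩ := hx.2
    have h := hP.sum_le (compl_compl D') hD (e₀ := ⟨(x, y), hxy⟩) hx
    have hw : ∀ x, vertexIndicator D'ᶜ x = 1 - vertexIndicator D' x := by
      intro x
      by_cases h : x ∈ D' <;> simp [vertexIndicator, h]
    have hδ' : ∀ x y, G.Adj x y → δ x * δ y * vertexIndicator D' x = δ x * δ y := by
      intro x y hxy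
      rw [← hδδ x y hxy]
      rcases vertexIndicator_eq_zero_or_one D' x with h | h <;> simp [h]
    have hsub : ∀ x, vertexIndicator D' x * δ x = vertexIndicator D' x := by
      intro x
      by_cases hx : x ∈ D'
      · rw [hδ, vertexIndicator_of_mem hx.1, mul_one]
      · rw [vertexIndicator_of_notMem hx, zero_mul]
    have h0 : ∀ e : G.Dart, vertexIndicator D' e.fst * δ (P.facePerm e).fst *
        δ (P.facePerm (P.facePerm e)).fst
        = δ e.fst * δ (P.facePerm e).fst * δ (P.facePerm (P.facePerm e)).fst := by
      intro e
      linear_combination (-(δ (P.facePerm e).fst * δ (P.facePerm (P.facePerm e)).fst))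
        * hsub e.fst + δ (P.facePerm (P.facePerm e)).fst * hδ' _ _ (adj1 e)
    have e1 : ∀ e : G.Dart, vertexIndicator D'ᶜ e.fst * vertexIndicator D' (P.facePerm e).fst *
          vertexIndicator D' (P.facePerm (P.facePerm e)).fst
        = c e.fst * δ (P.facePerm e).fst * δ (P.facePerm (P.facePerm e)).fst := by
      intro e
      rw [hw]
      linear_combination (1 - vertexIndicator D' e.fst) * hδδ _ _ (adj2 e) - h0 e
        - (δ (P.facePerm e).fst * δ (P.facePerm (P.facePerm e)).fst) * hsum e.fst
        + δ (P.facePerm (P.facePerm e)).fst * haδ _ _ (adj1 e)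
    have e2 : ∀ e : G.Dart, vertexIndicator D' e.fst * vertexIndicator D' (P.facePerm e).fst *
          vertexIndicator D' (P.facePerm (P.facePerm e)).fst
        = δ e.fst * δ (P.facePerm e).fst * δ (P.facePerm (P.facePerm e)).fst := by
      intro e
      linear_combination vertexIndicator D' e.fst * hδδ _ _ (adj2 e) + h0 e
    simpa only [e1, e2] using h
  have hdeg' : (5 * D.ncard : ℤ) ≤ ∑ e : G.Dart, δ e.fst := mul_ncard_le_sum_dart hdeg
  have hSα : 0 ≤ Sα :=
    Finset.sum_nonneg fun e _ => mul_nonneg (mul_nonneg (h01 _ _) (h01 _ _)) (h01 _ _)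
  -- The degree bound and `first` give `9|D| ≤ 2Sα + 3Sβ + 9`. If `D'` is nonempty, `second` and
  -- `hβ` bound the right side by `9|D'| - 3`, which is impossible; otherwise `Sα = Sβ = 0`.
  rcases D'.eq_empty_or_nonempty with h | h
  · have hzero : ∀ x y, G.Adj x y → δ x * δ y = 0 := fun x y hxy => by
      rw [← hδδ x y hxy, vertexIndicator_of_notMem (by simp [h]), zero_mul]
    have h1 : Sα = 0 := Finset.sum_eq_zero fun e _ => by rw [hzero _ _ (adj1 e), zero_mul]
    have h2 : Sβ = 0 := Finset.sum_eq_zero fun e _ => by rw [mul_assoc, hzero _ _ (adj2 e), mul_zero]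
    omega
  · have := second h
    omega

/-! ### Quadrangulations -/

theorem IsQuadrangulation.facePerm_four (hP : P.IsQuadrangulation) (e : G.Dart) :
    P.facePerm (P.facePerm (P.facePerm (P.facePerm e))) = e := (hP e).1

theorem IsQuadrangulation.sum_rotate [Fintype G.Dart] (hP : P.IsQuadrangulation)
    (F : V → V → V → V → ℤ) :
    ∑ e : G.Dart, F (P.facePerm e).fst (P.facePerm (P.facePerm e)).fst
        (P.facePerm (P.facePerm (P.facePerm e))).fst e.fst
      = ∑ e : G.Dart, F e.fst (P.facePerm e).fst (P.facePerm (P.facePerm e)).fst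
        (P.facePerm (P.facePerm (P.facePerm e))).fst := by
  rw [← Equiv.sum_comp P.facePerm fun e : G.Dart =>
    F e.fst (P.facePerm e).fst (P.facePerm (P.facePerm e)).fst
      (P.facePerm (P.facePerm (P.facePerm e))).fst]
  simp only [hP.facePerm_four]

theorem IsQuadrangulation.adj_fst_fourth (hP : P.IsQuadrangulation) (e : G.Dart) :
    G.Adj (P.facePerm (P.facePerm (P.facePerm e))).fst e.fst := by
  have h := (P.facePerm (P.facePerm (P.facePerm e))).adj
  rwa [← P.facePerm_fst, hP.facePerm_four] at h

/-- In a quadrangulation, if `Z` induces a connected subgraph and its complement `W` is such that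
the neighbors of `Z` in `W` are independent, then (each face being counted four times) the number
of faces with three or four corners in `W` is at most `|W| - 1`. -/
theorem IsQuadrangulation.sum_le [Finite V] [Fintype G.Dart] (hP : P.IsQuadrangulation)
    {Z : Set V} (hZ : (G.induce Z).Connected) {e₀ : G.Dart} (h₀ : e₀.fst ∉ Z)
    (hind : ∀ x ∈ Z, ∀ y ∉ Z, ∀ y' ∉ Z, ∀ x' ∈ Z, G.Adj x y → G.Adj y y' → ¬G.Adj y' x') :
    4 * ∑ e : G.Dart, vertexIndicator Z e.fst * (1 - vertexIndicator Z (P.facePerm e).fst) *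
          (1 - vertexIndicator Z (P.facePerm (P.facePerm e)).fst) *
          (1 - vertexIndicator Z (P.facePerm (P.facePerm (P.facePerm e))).fst)
      + ∑ e : G.Dart, (1 - vertexIndicator Z e.fst) * (1 - vertexIndicator Z (P.facePerm e).fst) *
          (1 - vertexIndicator Z (P.facePerm (P.facePerm e)).fst) *
          (1 - vertexIndicator Z (P.facePerm (P.facePerm (P.facePerm e))).fst)
      ≤ 4 * Zᶜ.ncard - 4 := by
  set z := vertexIndicator Z with hz
  have h1 := P.euler_le (by norm_num) hP hZ h₀
  have h2 := P.euler_dart (by norm_num) hP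
  have h3 : (Z.ncard : ℤ) + Zᶜ.ncard = Nat.card V := by exact_mod_cast Set.ncard_add_ncard_compl Z
  have hpow : ∀ e, (P.facePerm ^ 3) e = P.facePerm (P.facePerm (P.facePerm e)) := fun e => rfl
  simp only [Finset.prod_range_succ, Finset.prod_range_zero, one_mul, pow_zero,
    Equiv.Perm.one_apply, pow_one, pow_two, Equiv.Perm.mul_apply, ← P.facePerm_fst, hpow] at h1
  rw [← Finset.card_univ, Finset.card_eq_sum_ones] at h2
  push_cast at h1 h2
  have r1 := hP.sum_rotate fun x0 x1 x2 x3 => z x0 * z x1 * z x2 * (1 - z x3)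
  have r2 := hP.sum_rotate fun x0 x1 x2 x3 => z x3 * z x0 * z x1 * (1 - z x2)
  have r3 := hP.sum_rotate fun x0 x1 x2 x3 => z x2 * z x3 * z x0 * (1 - z x1)
  have s1 := hP.sum_rotate fun x0 x1 x2 x3 => z x0 * (1 - z x1) * (1 - z x2) * (1 - z x3)
  have s2 := hP.sum_rotate fun x0 x1 x2 x3 => z x3 * (1 - z x0) * (1 - z x1) * (1 - z x2)
  have s3 := hP.sum_rotate fun x0 x1 x2 x3 => z x2 * (1 - z x3) * (1 - z x0) * (1 - z x1)
  have h01 : ∀ x, 0 ≤ z x ∧ 0 ≤ 1 - z x := fun x => by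
    rcases vertexIndicator_eq_zero_or_one Z x with h | h <;> simp [hz, h]
  -- Faces with two adjacent corners in `W` would spoil the count, as only three of their edges meet
  -- `W`.
  have hzero : ∀ e : G.Dart, z e.fst * z (P.facePerm e).fst *
      (1 - z (P.facePerm (P.facePerm e)).fst) *
      (1 - z (P.facePerm (P.facePerm (P.facePerm e))).fst) = 0 := by
    intro e
    by_contra hne
    simp only [mul_eq_zero, not_or, hz] at hne
    have hmem : ∀ x, vertexIndicator Z x ≠ 0 → x ∈ Z := fun x hx => by
      by_contra h; exact hx (vertexIndicator_of_notMem h)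
    have hnot : ∀ x, 1 - vertexIndicator Z x ≠ 0 → x ∉ Z := fun x hx h =>
      hx (by rw [vertexIndicator_of_mem h, sub_self])
    refine hind _ (hmem _ hne.1.1.2) _ (hnot _ hne.1.2) _ (hnot _ hne.2) _ (hmem _ hne.1.1.1)
      ?_ ?_ (hP.adj_fst_fourth e)
    · rw [P.facePerm_fst (P.facePerm e)]; exact (P.facePerm e).adj
    · rw [P.facePerm_fst (P.facePerm (P.facePerm e))]; exact (P.facePerm (P.facePerm e)).adj
  have t1 := hP.sum_rotate fun x0 x1 x2 x3 => z x0 * z x1 * (1 - z x2) * (1 - z x3)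
  have t2 := hP.sum_rotate fun x0 x1 x2 x3 => z x3 * z x0 * (1 - z x1) * (1 - z x2)
  have t3 := hP.sum_rotate fun x0 x1 x2 x3 => z x2 * z x3 * (1 - z x0) * (1 - z x1)
  have t0 := Finset.sum_eq_zero fun (e : G.Dart) (_ : e ∈ Finset.univ) => hzero e
  have p1 : 0 ≤ ∑ e : G.Dart, z e.fst * (1 - z (P.facePerm e).fst) *
      z (P.facePerm (P.facePerm e)).fst *
      (1 - z (P.facePerm (P.facePerm (P.facePerm e))).fst) :=
    Finset.sum_nonneg fun e _ => mul_nonneg (mul_nonneg (mul_nonneg (h01 _).1 (h01 _).2)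
      (h01 _).1) (h01 _).2
  have p2 := hP.sum_rotate fun x0 x1 x2 x3 => z x0 * (1 - z x1) * z x2 * (1 - z x3)
  have key1 : ∑ e : G.Dart, z e.fst * z (P.facePerm e).fst
      = ∑ e : G.Dart, z e.fst * z (P.facePerm e).fst * z (P.facePerm (P.facePerm e)).fst *
          z (P.facePerm (P.facePerm (P.facePerm e))).fst
        + ∑ e : G.Dart, z e.fst * z (P.facePerm e).fst * z (P.facePerm (P.facePerm e)).fst *
          (1 - z (P.facePerm (P.facePerm (P.facePerm e))).fst)
        + ∑ e : G.Dart, z (P.facePerm (P.facePerm (P.facePerm e))).fst * z e.fst *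
          z (P.facePerm e).fst * (1 - z (P.facePerm (P.facePerm e)).fst)
        + ∑ e : G.Dart, z e.fst * z (P.facePerm e).fst * (1 - z (P.facePerm (P.facePerm e)).fst) *
          (1 - z (P.facePerm (P.facePerm (P.facePerm e))).fst) := by
    simp only [← Finset.sum_add_distrib]
    exact Finset.sum_congr rfl fun e _ => by ring
  -- All sixteen patterns of corners, written so that each is a rotation of one of six.
  have key2 : ∑ e : G.Dart, (1 : ℤ)
      = ∑ e : G.Dart, z e.fst * z (P.facePerm e).fst * z (P.facePerm (P.facePerm e)).fst *
          z (P.facePerm (P.facePerm (P.facePerm e))).fst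
        + ∑ e : G.Dart, z e.fst * z (P.facePerm e).fst * z (P.facePerm (P.facePerm e)).fst *
          (1 - z (P.facePerm (P.facePerm (P.facePerm e))).fst)
        + ∑ e : G.Dart, z (P.facePerm (P.facePerm (P.facePerm e))).fst * z e.fst *
          z (P.facePerm e).fst * (1 - z (P.facePerm (P.facePerm e)).fst)
        + ∑ e : G.Dart, z (P.facePerm (P.facePerm e)).fst *
          z (P.facePerm (P.facePerm (P.facePerm e))).fst * z e.fst * (1 - z (P.facePerm e).fst)
        + ∑ e : G.Dart, z (P.facePerm e).fst * z (P.facePerm (P.facePerm e)).fst *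
          z (P.facePerm (P.facePerm (P.facePerm e))).fst * (1 - z e.fst)
        + ∑ e : G.Dart, z e.fst * z (P.facePerm e).fst * (1 - z (P.facePerm (P.facePerm e)).fst) *
          (1 - z (P.facePerm (P.facePerm (P.facePerm e))).fst)
        + ∑ e : G.Dart, z (P.facePerm (P.facePerm (P.facePerm e))).fst * z e.fst *
          (1 - z (P.facePerm e).fst) * (1 - z (P.facePerm (P.facePerm e)).fst)
        + ∑ e : G.Dart, z (P.facePerm (P.facePerm e)).fst *
          z (P.facePerm (P.facePerm (P.facePerm e))).fst * (1 - z e.fst) *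
          (1 - z (P.facePerm e).fst)
        + ∑ e : G.Dart, z (P.facePerm e).fst * z (P.facePerm (P.facePerm e)).fst *
          (1 - z (P.facePerm (P.facePerm (P.facePerm e))).fst) * (1 - z e.fst)
        + ∑ e : G.Dart, z e.fst * (1 - z (P.facePerm e).fst) *
          z (P.facePerm (P.facePerm e)).fst *
          (1 - z (P.facePerm (P.facePerm (P.facePerm e))).fst)
        + ∑ e : G.Dart, z (P.facePerm e).fst * (1 - z (P.facePerm (P.facePerm e)).fst) *
          z (P.facePerm (P.facePerm (P.facePerm e))).fst * (1 - z e.fst)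
        + ∑ e : G.Dart, z e.fst * (1 - z (P.facePerm e).fst) *
          (1 - z (P.facePerm (P.facePerm e)).fst) *
          (1 - z (P.facePerm (P.facePerm (P.facePerm e))).fst)
        + ∑ e : G.Dart, z (P.facePerm (P.facePerm (P.facePerm e))).fst * (1 - z e.fst) *
          (1 - z (P.facePerm e).fst) * (1 - z (P.facePerm (P.facePerm e)).fst)
        + ∑ e : G.Dart, z (P.facePerm (P.facePerm e)).fst *
          (1 - z (P.facePerm (P.facePerm (P.facePerm e))).fst) * (1 - z e.fst) *
          (1 - z (P.facePerm e).fst)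
        + ∑ e : G.Dart, z (P.facePerm e).fst * (1 - z (P.facePerm (P.facePerm e)).fst) *
          (1 - z (P.facePerm (P.facePerm (P.facePerm e))).fst) * (1 - z e.fst)
        + ∑ e : G.Dart, (1 - z e.fst) * (1 - z (P.facePerm e).fst) *
          (1 - z (P.facePerm (P.facePerm e)).fst) *
          (1 - z (P.facePerm (P.facePerm (P.facePerm e))).fst) := by
    simp only [← Finset.sum_add_distrib]
    exact Finset.sum_congr rfl fun e _ => by ring
  linarith

/-- All neighbors of a vertex of color `false` outside `A` are outside `A`, so its corners lie on
faces with three or four outer corners. Such faces have one and two corners of this kind,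
respectively. Hence `3|X| ≤ q₃ + 2q₄`, while `q₃ ≥ |S|` and `q₃ + q₄ ≤ |Aᶜ| - 1`. -/
theorem IsQuadrangulation.ncard_bound [Finite V] (hP : P.IsQuadrangulation) {A S : Set V}
    {c : V → Bool} (hc : ∀ x y, G.Adj x y → c x = !c y) (hA : (G.induce A).Connected)
    (hAW : ∀ x ∈ A, ∀ y ∉ A, G.Adj x y → c y = true) (hSne : S.Nonempty)
    (hS : ∀ x ∈ S, x ∉ A ∧ (∃ y ∈ A, G.Adj x y) ∧ ∃ y ∉ A, G.Adj x y)
    (hdeg : ∀ x, x ∉ A → c x = false → 3 ≤ (G.neighborSet x).ncard) :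
    6 * {x | x ∉ A ∧ c x = false}.ncard + 2 * S.ncard + 4 ≤ 4 * Aᶜ.ncard := by
  have := Fintype.ofFinite G.Dart
  have adj1 : ∀ e : G.Dart, G.Adj e.fst (P.facePerm e).fst := fun e => by
    rw [P.facePerm_fst]; exact e.adj
  have adj4 := hP.adj_fst_fourth
  have hcA : ∀ x ∉ A, c x = false → ∀ y, G.Adj x y → y ∉ A := fun x hx hcx y hxy hy => by
    have := hAW y hy x hx hxy.symm
    simp [hcx] at this
  obtain ⟨x, hx⟩ := hSne
  obtain ⟨hxA, ⟨y, -, hxy⟩, -⟩ := hS x hx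
  have main := hP.sum_le hA (e₀ := ⟨(x, y), hxy⟩) hxA (by
    intro x hx y hy y' hy' x' hx' hxy hyy' hyx'
    have h1 := hAW x hx y hy hxy
    have h2 := hAW x' hx' y' hy' hyx'.symm
    have h3 := hc y y' hyy'
    simp [h1, h2] at h3)
  set z := vertexIndicator A with hz
  set X : Set V := {x | x ∉ A ∧ c x = false} with hX
  set b := vertexIndicator X with hb
  have z01 : ∀ x, 0 ≤ z x ∧ 0 ≤ 1 - z x := fun x => by
    rcases vertexIndicator_eq_zero_or_one A x with h | h <;> simp [hz, h]
  have hbz : ∀ x, 0 ≤ b x ∧ b x ≤ 1 - z x := by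
    intro x
    by_cases h1 : x ∈ A <;> by_cases h2 : c x = false <;>
      simp [hb, hz, vertexIndicator, hX, h1, h2]
  have hbz0 : ∀ x y, G.Adj x y → b x * z y = 0 := by
    intro x y hxy
    by_cases h : x ∈ X
    · rw [hz, vertexIndicator_of_notMem (hcA x h.1 h.2 y hxy), mul_zero]
    · rw [hb, vertexIndicator_of_notMem h, zero_mul]
  -- adjacent vertices outside of `A` have different colors
  have hbb : ∀ x y, G.Adj x y → (1 - z x - b x) * (1 - z y) = (1 - z x) * b y := by
    intro x y hxy
    have h := hc x y hxy
    by_cases h1 : x ∈ A <;> by_cases h2 : y ∈ A <;> by_cases h3 : c y = false <;>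
      simp [hb, hz, vertexIndicator, hX, h, h1, h2, h3]
  have hU : (S.ncard : ℤ) ≤ ∑ e : G.Dart, z e.fst * (1 - z (P.facePerm e).fst) *
      (1 - z (P.facePerm (P.facePerm e)).fst) *
      (1 - z (P.facePerm (P.facePerm (P.facePerm e))).fst) := by
    refine ncard_le_sum_dart S (fun e => (P.facePerm e).fst) _ (fun e => mul_nonneg (mul_nonneg
      (mul_nonneg (z01 _).1 (z01 _).2) (z01 _).2) (z01 _).2) fun x hx => ?_
    obtain ⟨hxA, ⟨y, hy, hxy⟩, w, hw, hxw⟩ := hS x hx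
    obtain ⟨e, he1, he2, he3⟩ := P.exists_corner (· ∈ A) hxy hxw hy hw
    have h1 : (P.facePerm e).fst ∉ A := he1 ▸ hxA
    have h2 : c (P.facePerm (P.facePerm e)).fst = false := by
      have h3 := hAW _ he2 _ h1 (adj1 e)
      have h4 := hc _ _ (adj1 (P.facePerm e))
      rw [h3] at h4
      simpa using h4.symm
    refine ⟨e, he1, ?_⟩
    rw [hz, vertexIndicator_of_mem he2, vertexIndicator_of_notMem h1, vertexIndicator_of_notMem he3,
      vertexIndicator_of_notMem (hcA _ he3 h2 _ (adj1 _))]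
    norm_num
  have hdeg' : ((3 : ℕ) * X.ncard : ℤ) ≤ ∑ e : G.Dart, b e.fst :=
    mul_ncard_le_sum_dart fun x hx => hdeg x hx.1 hx.2
  have s1 := hP.sum_rotate fun x0 x1 x2 x3 => z x0 * (1 - z x1) * (1 - z x2) * (1 - z x3)
  have s2 := hP.sum_rotate fun x0 x1 x2 x3 => z x3 * (1 - z x0) * (1 - z x1) * (1 - z x2)
  have s3 := hP.sum_rotate fun x0 x1 x2 x3 => z x2 * (1 - z x3) * (1 - z x0) * (1 - z x1)
  have s4 := hP.sum_rotate fun x0 x1 x2 x3 => b x0 * (1 - z x1) * (1 - z x2) * (1 - z x3)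
  -- Split by the corner opposite to the `false` one: in `A` (the face counts in `q₃`) or not (in
  -- `q₄`).
  have e1 : ∑ e : G.Dart, b e.fst ≤ ∑ e : G.Dart, z (P.facePerm (P.facePerm e)).fst *
        (1 - z (P.facePerm (P.facePerm (P.facePerm e))).fst) * (1 - z e.fst) *
        (1 - z (P.facePerm e).fst)
      + ∑ e : G.Dart, b e.fst * (1 - z (P.facePerm e).fst) *
        (1 - z (P.facePerm (P.facePerm e)).fst) *
        (1 - z (P.facePerm (P.facePerm (P.facePerm e))).fst) := by
    rw [← Finset.sum_add_distrib]
    refine Finset.sum_le_sum fun e _ => ?_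
    have h1 := hbz0 _ _ (adj1 e)
    have h2 := hbz0 _ _ (adj4 e).symm
    have h3 : b e.fst = b e.fst * (1 - z (P.facePerm e).fst) *
        (1 - z (P.facePerm (P.facePerm (P.facePerm e))).fst) := by
      linear_combination (1 - z (P.facePerm (P.facePerm (P.facePerm e))).fst) * h1 + h2
    have h4 := mul_le_mul_of_nonneg_left (hbz e.fst).2 (mul_nonneg (mul_nonneg
      (z01 (P.facePerm (P.facePerm e)).fst).1
      (z01 (P.facePerm (P.facePerm (P.facePerm e))).fst).2) (z01 (P.facePerm e).fst).2)
    linear_combination h3 + h4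
  have e2 : ∑ e : G.Dart, (1 - z e.fst) * (1 - z (P.facePerm e).fst) *
          (1 - z (P.facePerm (P.facePerm e)).fst) *
          (1 - z (P.facePerm (P.facePerm (P.facePerm e))).fst)
      = ∑ e : G.Dart, b e.fst * (1 - z (P.facePerm e).fst) *
        (1 - z (P.facePerm (P.facePerm e)).fst) *
        (1 - z (P.facePerm (P.facePerm (P.facePerm e))).fst)
      + ∑ e : G.Dart, b (P.facePerm e).fst * (1 - z (P.facePerm (P.facePerm e)).fst) *
        (1 - z (P.facePerm (P.facePerm (P.facePerm e))).fst) * (1 - z e.fst) := by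
    rw [← Finset.sum_add_distrib]
    refine Finset.sum_congr rfl fun e _ => ?_
    linear_combination (1 - z (P.facePerm (P.facePerm e)).fst) *
        (1 - z (P.facePerm (P.facePerm (P.facePerm e))).fst) * hbb _ _ (adj1 e)
  have final : (6 * X.ncard + 2 * S.ncard + 4 : ℤ) ≤ 4 * Aᶜ.ncard := by
    push_cast at hdeg'
    linarith
  exact_mod_cast final

/-- In a quadrangulation adjacent vertices have distances of different parity from any vertex. -/
theorem IsQuadrangulation.even_dist_add [Finite V] (hP : P.IsQuadrangulation) (v : V) {x y : V}
    (h : G.Adj x y) : ¬Even (G.dist v x + G.dist v y) := by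
  obtain ⟨c, hc⟩ := P.exists_two_coloring (by norm_num) (by decide) hP ⟨(x, y), h⟩
  have key : ∀ u, c v = if Even (G.dist v u) then c u else !c u := by
    intro u
    obtain ⟨w, hw⟩ := P.connected.exists_walk_length_eq_dist v u
    rw [← hw]
    exact RotationSystem.eq_ite_even_length_of_walk hc w
  have h1 := key x
  have h2 := key y
  have h3 := hc x y h
  rw [h1, h3] at h2
  rw [Nat.even_add]
  intro h4
  by_cases h5 : Even (G.dist v y) <;> cases h6 : c y <;> simp [h4, h5, h6] at h2


/-! ### Application to distance layers -/

theorem _root_.SimpleGraph.Connected.layerCard_eq (hG : G.Connected) (v : V) (i : ℕ) :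
    G.layerCard v i = {u | G.dist v u = i}.ncard := by
  unfold layerCard distLayer
  congr 1
  ext u
  change G.edist v u = i ↔ G.dist v u = i
  rw [← (hG v u).coe_dist_eq_edist]
  exact Nat.cast_inj

theorem _root_.SimpleGraph.Connected.induce_dist_lt (hG : G.Connected) (v : V) {j : ℕ}
    (hj : 0 < j) : (G.induce {u | G.dist v u < j}).Connected := by
  refine connected_induce_of_dist (v := v) (by simpa using hj) fun u hu huv => ?_
  obtain ⟨w, h1, h2⟩ := hG.exists_adj_dist_lt huv
  have hu' : G.dist v u < j := hu
  exact ⟨w, show G.dist v w < j by omega, h1, by omega⟩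

theorem _root_.SimpleGraph.Connected.exists_adj_dist_lt_of_eq (hG : G.Connected) {v : V} {j : ℕ}
    (hj : 0 < j) {x : V} (hx : G.dist v x = j) : ∃ y, G.Adj x y ∧ G.dist v y < j := by
  obtain ⟨w, h1, h2⟩ := hG.exists_adj_dist_lt (v := v) (u := x) (by rintro rfl; simp at hx; omega)
  exact ⟨w, h1.symm, by omega⟩

theorem IsTriangulation.ncard_last_layer_le_one [Finite V] (hP : P.IsTriangulation)
    (h5 : G.IsVertexConnected 5) {v u₀ : V} {d : ℕ} (hd : 2 ≤ d) (hle : ∀ u, G.dist v u ≤ d)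
    (hu₀ : G.dist v u₀ = d) (hcard : {u | G.dist v u = d - 1}.ncard = 5) :
    {u | G.dist v u = d}.ncard ≤ 1 := by
  have hG := P.connected
  refine hP.ncard_le_one (A := {u | G.dist v u < d - 1}) (C := {u | G.dist v u = d - 1})
    (fun x => ?_) (fun x y hxy hx hy => ?_) (hG.induce_dist_lt v (by omega)) ?_ (fun x hx => ?_)
    (fun x hx => ?_) (fun x hx => ?_) hcard (fun x _ => h5.le_ncard_neighborSet x)
  · have := hle x
    simp only [Set.mem_ofPred_eq]
    omega
  · have h1 := hxy.dist_le_add_one hG v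
    have h2 : G.dist v x < d - 1 := hx
    have h3 : G.dist v y = d := hy
    omega
  -- The predecessor on a geodesic from `v` is at distance less than `d`, hence never in the removed
  -- set.
  · refine connected_induce_of_dist (v := v) (fun h => ?_) fun u hu huv => ?_
    · have : G.dist v v = d := h.1
      rw [dist_self] at this
      omega
    · obtain ⟨w, h1, h2⟩ := hG.exists_adj_dist_lt huv
      have := hle u
      refine ⟨w, fun h => ?_, h1, by omega⟩
      have : G.dist v w = d := h.1
      omega
  · obtain ⟨y, h1, h2⟩ := hG.exists_adj_dist_lt_of_eq (by omega) hx
    exact ⟨y, h2, h1⟩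
  · obtain ⟨y, h1, h2⟩ := h5.exists_adj_dist_gt hG (by omega) hcard.le hx
      (u := u₀) (by omega)
    have := hle y
    exact ⟨y, show G.dist v y = d by omega, h1⟩
  · obtain ⟨y, h1, h2⟩ := hG.exists_adj_dist_lt_of_eq (by omega) hx
    have h3 := h1.symm.dist_le_add_one hG v
    have h4 : G.dist v x = d := hx
    exact ⟨y, show G.dist v y = d - 1 by omega, h1⟩

theorem IsQuadrangulation.ncard_layer_bound [Finite V] (hP : P.IsQuadrangulation)
    (h3 : G.IsVertexConnected 3) {v u₀ : V} {j : ℕ} (hj : 0 < j) (hu₀ : j < G.dist v u₀)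
    (hcard : {u | G.dist v u = j}.ncard = 3) :
    6 * {u | j < G.dist v u ∧ ¬Even (G.dist v u + j)}.ncard + 10
      ≤ 4 * {u | j ≤ G.dist v u}.ncard := by
  have hG := P.connected
  have h := hP.ncard_bound (A := {u | G.dist v u < j}) (S := {u | G.dist v u = j})
    (c := fun u => decide (Even (G.dist v u + j))) (fun x y hxy => ?_) (hG.induce_dist_lt v hj)
    (fun x hx y hy hxy => ?_) ((Set.ncard_pos (Set.toFinite _)).1 (by omega)) (fun x hx => ?_)
    (fun x _ _ => h3.le_ncard_neighborSet x)
  · rw [hcard] at h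
    have e1 : {u | G.dist v u < j}ᶜ = {u | j ≤ G.dist v u} := by ext; simp
    have e2 : {x | x ∉ {u | G.dist v u < j} ∧ decide (Even (G.dist v x + j)) = false}
        = {u | j < G.dist v u ∧ ¬Even (G.dist v u + j)} := by
      ext x
      simp only [Set.mem_ofPred_eq, decide_eq_false_iff_not, not_lt]
      refine ⟨fun h => ⟨lt_of_le_of_ne h.1 ?_, h.2⟩, fun h => ⟨h.1.le, h.2⟩⟩
      intro heq
      exact h.2 (heq ▸ ⟨j, rfl⟩)
    rw [e1, e2] at h
    omega
  · have := hP.even_dist_add v hxy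
    have h2 : Even (G.dist v x + j) ↔ ¬Even (G.dist v y + j) := by
      rw [Nat.even_add] at this ⊢
      rw [Nat.even_add]
      tauto
    rw [decide_eq_decide.2 h2, decide_not]
  · have h1 := hxy.dist_le_add_one hG v
    have h2 : G.dist v x < j := hx
    have h3 : ¬G.dist v y < j := hy
    have h4 : G.dist v y = j := by omega
    simp [h4]
  · have hx' : G.dist v x = j := hx
    obtain ⟨y, h1, h2⟩ := hG.exists_adj_dist_lt_of_eq hj hx
    obtain ⟨z, h4, h5⟩ := h3.exists_adj_dist_gt hG hj hcard.le hx hu₀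
    exact ⟨by simp [hx'], ⟨y, h2, h1⟩, z, by simpa using h5.le, h4⟩

end
end PlaneEmbedding
end SimpleGraph

theorem mainTheorem5 {V : Type*} [Finite V] (G : SimpleGraph V) (P : G.PlaneEmbedding)
    (v : V) (d : ℕ) (hd : G.eccent v = (d : ℕ∞)) :
    (P.IsTriangulation → G.IsVertexConnected 5 →
      G.layerCard v (d - 1) = 5 → G.layerCard v d = 1) ∧
    (P.IsQuadrangulation → G.IsVertexConnected 3 →
      (G.layerCard v (d - 1) = 3 → G.layerCard v d = 1) ∧
      (G.layerCard v (d - 2) = 3 → G.layerCard v (d - 1) = 4 → 1 < G.layerCard v d)) := by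
  have hG := P.connected
  have hle : ∀ u, G.dist v u ≤ d := fun u => by
    have := G.edist_le_eccent (u := v) (v := u)
    rw [hd, ← (hG v u).coe_dist_eq_edist] at this
    exact_mod_cast this
  obtain ⟨u₀, hu₀⟩ : ∃ u₀, G.dist v u₀ = d := by
    have : Nonempty V := ⟨v⟩
    obtain ⟨u, hu⟩ := G.exists_edist_eq_eccent_of_finite v
    rw [hd, ← (hG v u).coe_dist_eq_edist] at hu
    exact ⟨u, by exact_mod_cast hu⟩
  have hpos : 0 < {u | G.dist v u = d}.ncard := (Set.ncard_pos (Set.toFinite _)).2 ⟨u₀, hu₀⟩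
  have hzero : {u | G.dist v u = 0}.ncard = 1 := by
    rw [Set.ncard_eq_one]
    refine ⟨v, Set.ext fun u => ?_⟩
    change G.dist v u = 0 ↔ u = v
    rw [hG.dist_eq_zero_iff, eq_comm]
  -- A layer of size 3 or 5 is not layer `0`, so `d - 1` or `d - 2` is positive and the subtraction
  -- is not truncated.
  have hlarge : ∀ i, {u | G.dist v u = i}.ncard = 1 ∨ 0 < i := by
    intro i
    rcases Nat.eq_zero_or_pos i with rfl | h
    · exact Or.inl hzero
    · exact Or.inr h
  have hdisj : ∀ i, {u | i ≤ G.dist v u}.ncard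
      = {u | G.dist v u = i}.ncard + {u | i + 1 ≤ G.dist v u}.ncard := by
    intro i
    rw [← Set.ncard_union_eq _ (Set.toFinite _) (Set.toFinite _)]
    · congr 1
      ext u
      simp only [Set.mem_ofPred_eq, Set.mem_union]
      omega
    · refine Set.disjoint_left.2 fun u h1 h2 => ?_
      simp only [Set.mem_ofPred_eq] at h1 h2
      omega
  have hlast : {u | d ≤ G.dist v u} = {u | G.dist v u = d} := Set.ext fun u => by
    have := hle u
    simp only [Set.mem_ofPred_eq]
    omega
  simp only [hG.layerCard_eq]
  refine ⟨fun hP h5 h => ?_, fun hP h3 => ⟨fun h => ?_, fun h h' => ?_⟩⟩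
  · have := hlarge (d - 1)
    exact le_antisymm (hP.ncard_last_layer_le_one h5 (by omega) hle hu₀ h) hpos
  · have := hlarge (d - 1)
    have hb := hP.ncard_layer_bound h3 (by omega) (u₀ := u₀) (by omega) h
    have e1 : {u | d - 1 < G.dist v u ∧ ¬Even (G.dist v u + (d - 1))}
        = {u | G.dist v u = d} := Set.ext fun u => by
      have := hle u
      simp only [Set.mem_ofPred_eq, Nat.even_iff]
      omega
    -- The bound reads `6 n_d + 10 ≤ 4 (3 + n_d)`.
    rw [e1, hdisj, Nat.sub_add_cancel (by omega), hlast, h] at hb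
    omega
  · have := hlarge (d - 2)
    have hb := hP.ncard_layer_bound h3 (by omega) (u₀ := u₀) (by omega) h
    have e1 : {u | d - 2 < G.dist v u ∧ ¬Even (G.dist v u + (d - 2))}
        = {u | G.dist v u = d - 1} := Set.ext fun u => by
      have := hle u
      simp only [Set.mem_ofPred_eq, Nat.even_iff]
      omega
    -- Only layer `d - 1` has the other parity, so the bound reads `6 * 4 + 10 ≤ 4 (3 + 4 + n_d)`.
    rw [e1, hdisj, show d - 2 + 1 = d - 1 by omega, hdisj (d - 1), Nat.sub_add_cancel (by omega),
      hlast, h, h'] at hb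
    omega
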